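/- Let $d\in\{2,3\}$ and let $\Omega\subset\mathbb R^d$ be a bounded convex domain with polygonal or polyhedral boundary, i.e. the non-empty interior of the convex hull of a finite set. Let $\|u\|_{0}$ denote the norm of $L^2(\Omega)$ or $[L^2(\Omega)]^d$, with inner product $(\cdot,\cdot)_0$, let $\|u\|_1=(\|u\|_0^2+\|\nabla u\|_0^2)^{1/2}$ be the norm of $H^1(\Omega)$, and let $H^1_0(\Omega)$ be the closure of $C_c^\infty(\Omega)$ in $H^1(\Omega)$. For $u,v\in H^1(\Omega)$ and $\sigma,\tau\in[L^2(\Omega)]^d$ put $$a((u,\sigma),(v,\tau))=(\sigma,\tau)_0+(\sigma-2\nabla u,\tau-2\nabla v)_0 .$$ Meshes. Let $\hat T$ be the open reference simplex $\{x: x_i>0,\ \sum_i x_i<1\}$ or the open reference square or cube $(0,1)^d$. For $k\ge 0$ let $\mathcal Q_k(\hat T)$ be the polynomials of total degree at most $k$ if $\hat T$ is the simplex, and the polynomials of degree at most $k$ in each variable if $\hat T$ is the square or cube. A mesh $\mathcal T$ of $\Omega$ is a finite family of pairwise disjoint sets $T=F_T(\hat T)\subset\Omega$, where each $T$ has one of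 these reference elements, such that $\overline\Omega=\bigcup_T\overline T$; here $F_T$ is injective on the closure of $\hat T$ and has components in $\mathcal Q_1(\hat T)$ (so $F_T$ is affine for a simplex, and multilinear, in particular possibly affine, for a quadrilateral or hexahedron). With $h=\max_T\operatorname{diam}T$, the mesh is quasi-uniform with constant $\rho>0$ if every $T$ contains a ball of radius $\rho h$. Finite element spaces. Let $S_h$ be the space of continuous functions $v\in H^1(\Omega)$ such that $v|_T\circ F_T\in\mathcal Q_k(\hat T)$ for each $T$; let $V_h=S_h\cap H^1_0(\Omega)$ and $\mathbf V_h=[V_h]^d$. Let $L_h$ be the space of $v\in L^2(\Omega)$ such that $v|_T\circ F_T\in\mathcal Q_k(\hat T)$ for each $T$, and $\mathbf Q_h=[L_h]^d$. Theorem. There is a constant $c>0$ that depends only on $\Omega$ such that the following holds for every $\rho>0$, every mesh of $\Omega$ that is quasi-uniform with constant $\rho$, every $k\ge0$, every $\ell\in H^{-1}(\Omega)=H^1_0(\Omega)'$, and both choices $\mathbf M_h=\mathbf Q_h$ and $\mathbf M_h=\mathbf V_h$. There is exactly one $(u_h,\sigma_h)\in V_h\times \mathbf M_h$ with $$a((u_h,\sigma_h),(v_h,\tau_h))=2\ell(v_h)\qquad\text{for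 all }(v_h,\tau_h)\in V_h\times \mathbf M_h .$$ If $u\in H^1_0(\Omega)$ minimises $K(v)=\frac12\int_\Omega|\nabla v|^2\,dx-\ell(v)$ over $H^1_0(\Omega)$ and $\sigma=\nabla u$, then $$\|u-u_h\|_1+\|\sigma-\sigma_h\|_0\le c\Bigl(\inf_{v_h\in V_h}\|u-v_h\|_1+\inf_{\tau_h\in \mathbf M_h}\|\sigma-\tau_h\|_0\Bigr).$$ -/

import Mathlib

open MeasureTheory Set
open scoped ENNReal ContDiff

noncomputable section

namespace PoissonFEM

/-! ### Domains -/

/-- `ℝᵈ` with its Euclidean norm. -/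
abbrev Space (d : ℕ) : Type := EuclideanSpace ℝ (Fin d)

/-- A bounded convex domain with polygonal or polyhedral boundary, i.e. the nonempty interior of the
convex hull of finitely many points. -/
def IsConvexPolyhedralDomain {d : ℕ} (Ω : Set (Space d)) : Prop :=
  Ω.Nonempty ∧ ∃ S : Set (Space d), S.Finite ∧ Ω = interior (convexHull ℝ S)

/-! ### The spaces `L²`, `H¹`, `H¹₀` -/

section Sobolev

variable {d : ℕ}

/-- `L²(Ω)`. -/
abbrev L2 (Ω : Set (Space d)) := Lp ℝ 2 (volume.restrict Ω)

/-- `[L²(Ω)]ᵈ`, with `‖τ‖² = ∑ᵢ ‖τᵢ‖²`. -/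
abbrev L2Vec (Ω : Set (Space d)) := Lp (Space d) 2 (volume.restrict Ω)

/-- The `j`-th component `[L²(Ω)]ᵈ → L²(Ω)`. -/
def component (Ω : Set (Space d)) (j : Fin d) : L2Vec Ω →L[ℝ] L2 Ω :=
  (EuclideanSpace.proj j : Space d →L[ℝ] ℝ).compLpL 2 (volume.restrict Ω)

/-- `φ ∈ C_c^∞(Ω)`. -/
structure IsTestFunction (Ω : Set (Space d)) (φ : Space d → ℝ) : Prop where
  smooth : ContDiff ℝ ∞ φ
  compact : HasCompactSupport φ
  support : tsupport φ ⊆ Ω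

/-- The `j`-th partial derivative of a function on `ℝᵈ`. -/
def partialDeriv (j : Fin d) (φ : Space d → ℝ) (x : Space d) : ℝ :=
  fderiv ℝ φ x (EuclideanSpace.single j 1)

/-- `g` is the weak gradient of `u`: `∫_Ω u ∂ⱼφ = - ∫_Ω gⱼ φ` for all `φ ∈ C_c^∞(Ω)` and all `j`. -/
def IsWeakGradient (Ω : Set (Space d)) (u : L2 Ω) (g : L2Vec Ω) : Prop :=
  ∀ φ : Space d → ℝ, IsTestFunction Ω φ → ∀ j : Fin d,
    ∫ x in Ω, u x * partialDeriv j φ x = - ∫ x in Ω, g x j * φ x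

theorem IsTestFunction.memLp {Ω : Set (Space d)} {φ : Space d → ℝ} (h : IsTestFunction Ω φ) :
    MemLp φ 2 (volume.restrict Ω) :=
  (h.smooth.continuous.memLp_of_hasCompactSupport h.compact)

theorem IsTestFunction.memLp_partialDeriv {Ω : Set (Space d)} {φ : Space d → ℝ}
    (h : IsTestFunction Ω φ) (j : Fin d) :
    MemLp (partialDeriv j φ) 2 (volume.restrict Ω) := by
  have hc : Continuous (partialDeriv j φ) :=
    (h.smooth.continuous_fderiv (by simp)).clm_apply continuous_const
  exact hc.memLp_of_hasCompactSupport (h.compact.fderiv_apply (𝕜 := ℝ) _)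

theorem L2Vec.memLp_coord {Ω : Set (Space d)} (g : L2Vec Ω) (j : Fin d) :
    MemLp (fun x => g x j) 2 (volume.restrict Ω) :=
  (EuclideanSpace.proj j : Space d →L[ℝ] ℝ).comp_memLp' (Lp.memLp g)

theorem IsWeakGradient.add {Ω : Set (Space d)} {u v : L2 Ω} {g k : L2Vec Ω}
    (hu : IsWeakGradient Ω u g) (hv : IsWeakGradient Ω v k) :
    IsWeakGradient Ω (u + v) (g + k) := by
  intro φ hφ j
  have e1 : ∫ x in Ω, (u + v : L2 Ω) x * partialDeriv j φ x
      = ∫ x in Ω, (u x * partialDeriv j φ x + v x * partialDeriv j φ x) := by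
    refine integral_congr_ae ?_
    filter_upwards [Lp.coeFn_add u v] with x hx
    rw [hx, Pi.add_apply, add_mul]
  have e2 : ∫ x in Ω, (g + k : L2Vec Ω) x j * φ x
      = ∫ x in Ω, (g x j * φ x + k x j * φ x) := by
    refine integral_congr_ae ?_
    filter_upwards [Lp.coeFn_add g k] with x hx
    rw [hx, Pi.add_apply, PiLp.add_apply, add_mul]
  have i1 : Integrable (fun x => u x * partialDeriv j φ x) (volume.restrict Ω) :=
    (Lp.memLp u).integrable_mul (hφ.memLp_partialDeriv j)
  have i2 : Integrable (fun x => v x * partialDeriv j φ x) (volume.restrict Ω) :=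
    (Lp.memLp v).integrable_mul (hφ.memLp_partialDeriv j)
  have i3 : Integrable (fun x => g x j * φ x) (volume.restrict Ω) :=
    (L2Vec.memLp_coord g j).integrable_mul hφ.memLp
  have i4 : Integrable (fun x => k x j * φ x) (volume.restrict Ω) :=
    (L2Vec.memLp_coord k j).integrable_mul hφ.memLp
  rw [e1, e2, integral_add i1 i2, integral_add i3 i4, hu φ hφ j, hv φ hφ j]
  ring

theorem IsWeakGradient.smul {Ω : Set (Space d)} {u : L2 Ω} {g : L2Vec Ω} (c : ℝ)
    (hu : IsWeakGradient Ω u g) : IsWeakGradient Ω (c • u) (c • g) := by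
  intro φ hφ j
  have e1 : ∫ x in Ω, (c • u : L2 Ω) x * partialDeriv j φ x
      = ∫ x in Ω, c * (u x * partialDeriv j φ x) := by
    refine integral_congr_ae ?_
    filter_upwards [Lp.coeFn_smul c u] with x hx
    rw [hx, Pi.smul_apply, smul_eq_mul, mul_assoc]
  have e2 : ∫ x in Ω, (c • g : L2Vec Ω) x j * φ x = ∫ x in Ω, c * (g x j * φ x) := by
    refine integral_congr_ae ?_
    filter_upwards [Lp.coeFn_smul c g] with x hx
    rw [hx, Pi.smul_apply, PiLp.smul_apply, smul_eq_mul, mul_assoc]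
  rw [e1, e2, integral_const_mul, integral_const_mul, hu φ hφ j]
  ring

theorem IsWeakGradient.zero (Ω : Set (Space d)) : IsWeakGradient Ω (0 : L2 Ω) (0 : L2Vec Ω) := by
  intro φ _ j
  have e1 : ∫ x in Ω, (0 : L2 Ω) x * partialDeriv j φ x = ∫ _ in Ω, (0 : ℝ) := by
    refine integral_congr_ae ?_
    filter_upwards [Lp.coeFn_zero ℝ 2 (volume.restrict Ω)] with x hx
    rw [hx, Pi.zero_apply, zero_mul]
  have e2 : ∫ x in Ω, (0 : L2Vec Ω) x j * φ x = ∫ _ in Ω, (0 : ℝ) := by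
    refine integral_congr_ae ?_
    filter_upwards [Lp.coeFn_zero (Space d) 2 (volume.restrict Ω)] with x hx
    rw [hx, Pi.zero_apply, PiLp.zero_apply, zero_mul]
  rw [e1, e2]
  simp

/-- `H¹(Ω)`, realised as the space of pairs `(u, ∇u)`, `u ∈ L²(Ω)`, with weak gradient
`∇u ∈ [L²(Ω)]ᵈ`. The norm is `‖u‖₁ = (‖u‖₀² + ‖∇u‖₀²)^{1/2}`. -/
def H1 (Ω : Set (Space d)) : Submodule ℝ (WithLp 2 (L2 Ω × L2Vec Ω)) where
  carrier := {w | IsWeakGradient Ω w.fst w.snd}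
  add_mem' hu hv := hu.add hv
  zero_mem' := IsWeakGradient.zero Ω
  smul_mem' c _ hu := hu.smul c

/-- The function in `L²(Ω)` underlying an element of `H¹(Ω)`, as a linear map. -/
def H1.toL2 (Ω : Set (Space d)) : H1 Ω →ₗ[ℝ] L2 Ω where
  toFun w := w.1.fst
  map_add' _ _ := rfl
  map_smul' _ _ := rfl

/-- The weak gradient `∇ : H¹(Ω) → [L²(Ω)]ᵈ`. -/
def H1.grad (Ω : Set (Space d)) : H1 Ω →ₗ[ℝ] L2Vec Ω where
  toFun w := w.1.snd
  map_add' _ _ := rfl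
  map_smul' _ _ := rfl

theorem IsTestFunction.add {Ω : Set (Space d)} {φ ψ : Space d → ℝ} (hφ : IsTestFunction Ω φ)
    (hψ : IsTestFunction Ω ψ) : IsTestFunction Ω (φ + ψ) :=
  ⟨hφ.smooth.add hψ.smooth, hφ.compact.add hψ.compact,
    (tsupport_add φ ψ).trans (union_subset hφ.support hψ.support)⟩

theorem IsTestFunction.smul {Ω : Set (Space d)} {φ : Space d → ℝ} (c : ℝ)
    (hφ : IsTestFunction Ω φ) : IsTestFunction Ω (c • φ) :=
  ⟨hφ.smooth.const_smul c, hφ.compact.smul_left (f := fun _ => c),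
    (tsupport_smul_subset_right (fun _ => c) φ).trans hφ.support⟩

theorem IsTestFunction.zero (Ω : Set (Space d)) : IsTestFunction Ω (0 : Space d → ℝ) :=
  ⟨contDiff_const, HasCompactSupport.zero, by simp [tsupport]⟩

/-- `C_c^∞(Ω)` as a subspace of `H¹(Ω)`. -/
def testFunctions (Ω : Set (Space d)) : Submodule ℝ (H1 Ω) where
  carrier := {w | ∃ φ, IsTestFunction Ω φ ∧ H1.toL2 Ω w =ᵐ[volume.restrict Ω] φ}
  add_mem' := by
    rintro a b ⟨φ, hφ, ha⟩ ⟨ψ, hψ, hb⟩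
    refine ⟨φ + ψ, hφ.add hψ, ?_⟩
    rw [map_add]
    exact (Lp.coeFn_add _ _).trans (ha.add hb)
  zero_mem' := ⟨0, IsTestFunction.zero Ω, by rw [map_zero]; exact Lp.coeFn_zero _ _ _⟩
  smul_mem' := by
    rintro c a ⟨φ, hφ, ha⟩
    refine ⟨c • φ, hφ.smul c, ?_⟩
    rw [map_smul]
    exact (Lp.coeFn_smul _ _).trans (ha.const_smul c)

/-- `H¹₀(Ω)`, the closure of `C_c^∞(Ω)` in `H¹(Ω)`. -/
def H10 (Ω : Set (Space d)) : Submodule ℝ (H1 Ω) :=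
  (testFunctions Ω).topologicalClosure

/-- `H⁻¹(Ω)`, the dual of `H¹₀(Ω)`. -/
abbrev HNegOne (Ω : Set (Space d)) := StrongDual ℝ (H10 Ω)

end Sobolev

/-! ### The continuous problem -/

section Problem

variable {d : ℕ}

/-- The energy `K(v) = ½ ∫_Ω |∇v|² - ℓ(v)`. -/
def energy (Ω : Set (Space d)) (ℓ : HNegOne Ω) (v : H10 Ω) : ℝ :=
  1 / 2 * ‖H1.grad Ω v‖ ^ 2 - ℓ v

/-- `u` minimises `K` over `H¹₀(Ω)`, i.e. it solves the Poisson problem with datum `ℓ`. -/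
def IsExactSolution (Ω : Set (Space d)) (ℓ : HNegOne Ω) (u : H10 Ω) : Prop :=
  ∀ v : H10 Ω, energy Ω ℓ u ≤ energy Ω ℓ v

/-- `a((u,σ),(v,τ)) = (σ,τ)₀ + (σ - 2∇u, τ - 2∇v)₀`. -/
def bilin (Ω : Set (Space d)) (u : H1 Ω) (σ : L2Vec Ω) (v : H1 Ω) (τ : L2Vec Ω) : ℝ :=
  inner ℝ σ τ + inner ℝ (σ - (2 : ℝ) • H1.grad Ω u) (τ - (2 : ℝ) • H1.grad Ω v)

end Problem

/-! ### Meshes -/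

/-- The two kinds of reference elements. -/
inductive Shape
  | simplex
  | cube

/-- The open reference simplex, or the open reference square or cube `(0,1)ᵈ`. -/
def Shape.ref (d : ℕ) : Shape → Set (Space d)
  | .simplex => {x | (∀ i, 0 < x i) ∧ ∑ i, x i < 1}
  | .cube => {x | ∀ i, 0 < x i ∧ x i < 1}

/-- The polynomials `𝒬ₖ(T̂)`: total degree at most `k` on the simplex, degree at most `k` in each
variable on the square or cube. -/
def Shape.poly (d k : ℕ) : Shape → Submodule ℝ (MvPolynomial (Fin d) ℝ)
  | .simplex => MvPolynomial.restrictTotalDegree (Fin d) ℝ k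
  | .cube => MvPolynomial.restrictDegree (Fin d) ℝ k

/-- A partition of `Ω` into finitely many open elements `T = F_T(T̂)`: simplices (images of the
reference simplex under affine maps), or quadrilaterals and hexahedra (images of the reference
square or cube under maps with components in `𝒬₁(T̂)`, in particular under affine maps). -/
structure Mesh (d : ℕ) (Ω : Set (Space d)) where
  /-- The number of elements. -/
  n : ℕ
  /-- The kind of each element. -/
  shape : Fin n → Shape
  /-- The element maps `F_T`. -/
  map : Fin n → Space d → Space d
  map_poly : ∀ i j, ∃ p ∈ (shape i).poly d 1, ∀ x : Space d, map i x j = MvPolynomial.eval x p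
  map_injOn : ∀ i, InjOn (map i) (closure ((shape i).ref d))
  subset : ∀ i, map i '' (shape i).ref d ⊆ Ω
  disjoint : ∀ i j, i ≠ j → Disjoint (map i '' (shape i).ref d) (map j '' (shape j).ref d)
  cover : ⋃ i, closure (map i '' (shape i).ref d) = closure Ω

section MeshDefs

variable {d : ℕ} {Ω : Set (Space d)}

/-- The `i`-th element of a mesh. -/
def Mesh.element (𝒯 : Mesh d Ω) (i : Fin 𝒯.n) : Set (Space d) :=
  𝒯.map i '' (𝒯.shape i).ref d

/-- The mesh-size `h`, the largest diameter of an element. -/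
def Mesh.size (𝒯 : Mesh d Ω) : ℝ := ⨆ i, Metric.diam (𝒯.element i)

/-- The mesh is quasi-uniform with constant `ρ`: each element contains a ball of radius `ρ h`. A
family of meshes is quasi-uniform if this holds for all its members with the same `ρ > 0`. -/
def Mesh.IsQuasiUniform (𝒯 : Mesh d Ω) (ρ : ℝ) : Prop :=
  ∀ i, ∃ x, Metric.ball x (ρ * 𝒯.size) ⊆ 𝒯.element i

/-! ### Finite element spaces -/

/-- `r|_T = v̂ ∘ F_T⁻¹` with `v̂ ∈ 𝒬ₖ(T̂)`, for each element `T`. -/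
def Mesh.IsPiecewisePoly (𝒯 : Mesh d Ω) (k : ℕ) (r : Space d → ℝ) : Prop :=
  ∀ i, ∃ p ∈ (𝒯.shape i).poly d k, ∀ x ∈ (𝒯.shape i).ref d,
    r (𝒯.map i x) = MvPolynomial.eval x p

theorem Mesh.IsPiecewisePoly.add {𝒯 : Mesh d Ω} {k : ℕ} {r s : Space d → ℝ}
    (hr : 𝒯.IsPiecewisePoly k r) (hs : 𝒯.IsPiecewisePoly k s) : 𝒯.IsPiecewisePoly k (r + s) := by
  intro i
  obtain ⟨p, hp, hp'⟩ := hr i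
  obtain ⟨q, hq, hq'⟩ := hs i
  exact ⟨p + q, Submodule.add_mem _ hp hq, fun x hx => by simp [hp' x hx, hq' x hx]⟩

theorem Mesh.IsPiecewisePoly.smul {𝒯 : Mesh d Ω} {k : ℕ} {r : Space d → ℝ} (c : ℝ)
    (hr : 𝒯.IsPiecewisePoly k r) : 𝒯.IsPiecewisePoly k (c • r) := by
  intro i
  obtain ⟨p, hp, hp'⟩ := hr i
  exact ⟨c • p, Submodule.smul_mem _ c hp, fun x hx => by simp [hp' x hx]⟩

theorem Mesh.IsPiecewisePoly.zero (𝒯 : Mesh d Ω) (k : ℕ) : 𝒯.IsPiecewisePoly k 0 :=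
  fun _ => ⟨0, Submodule.zero_mem _, fun _ _ => by simp⟩

/-- `S_h`: the functions in `H¹(Ω)` that are continuous and piecewise in `𝒬ₖ`. -/
def Sh (𝒯 : Mesh d Ω) (k : ℕ) : Submodule ℝ (H1 Ω) where
  carrier := {w | ∃ r : Space d → ℝ, ContinuousOn r Ω ∧ 𝒯.IsPiecewisePoly k r ∧
    H1.toL2 Ω w =ᵐ[volume.restrict Ω] r}
  add_mem' := by
    rintro a b ⟨r, hr, hr', ha⟩ ⟨s, hs, hs', hb⟩
    refine ⟨r + s, hr.add hs, hr'.add hs', ?_⟩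
    rw [map_add]
    exact (Lp.coeFn_add _ _).trans (ha.add hb)
  zero_mem' := ⟨0, continuousOn_const, .zero 𝒯 k, by rw [map_zero]; exact Lp.coeFn_zero _ _ _⟩
  smul_mem' := by
    rintro c a ⟨r, hr, hr', ha⟩
    refine ⟨c • r, hr.const_smul c, hr'.smul c, ?_⟩
    rw [map_smul]
    exact (Lp.coeFn_smul _ _).trans (ha.const_smul c)

/-- `V_h = S_h ∩ H¹₀(Ω)`. -/
def Vh (𝒯 : Mesh d Ω) (k : ℕ) : Submodule ℝ (H1 Ω) := Sh 𝒯 k ⊓ H10 Ω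

/-- `L_h`: the functions in `L²(Ω)` that are piecewise in `𝒬ₖ`, without continuity. -/
def Lh (𝒯 : Mesh d Ω) (k : ℕ) : Submodule ℝ (L2 Ω) where
  carrier := {w | ∃ r : Space d → ℝ, 𝒯.IsPiecewisePoly k r ∧ w =ᵐ[volume.restrict Ω] r}
  add_mem' := by
    rintro a b ⟨r, hr', ha⟩ ⟨s, hs', hb⟩
    exact ⟨r + s, hr'.add hs', (Lp.coeFn_add _ _).trans (ha.add hb)⟩
  zero_mem' := ⟨0, .zero 𝒯 k, Lp.coeFn_zero _ _ _⟩
  smul_mem' := by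
    rintro c a ⟨r, hr', ha⟩
    exact ⟨c • r, hr'.smul c, (Lp.coeFn_smul _ _).trans (ha.const_smul c)⟩

/-- The vector fields in `[L²(Ω)]ᵈ` all of whose components lie in `W`. -/
def vectorFields (W : Submodule ℝ (L2 Ω)) : Submodule ℝ (L2Vec Ω) :=
  ⨅ j : Fin d, W.comap (component Ω j).toLinearMap

/-- `𝐐_h = [L_h]ᵈ`. -/
def Qh (𝒯 : Mesh d Ω) (k : ℕ) : Submodule ℝ (L2Vec Ω) := vectorFields (Lh 𝒯 k)

/-- `𝐕_h = [V_h]ᵈ`, as a subspace of `[L²(Ω)]ᵈ`. -/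
def VhVec (𝒯 : Mesh d Ω) (k : ℕ) : Submodule ℝ (L2Vec Ω) :=
  vectorFields ((Vh 𝒯 k).map (H1.toL2 Ω))

/-- `(u_h, σ_h) ∈ V_h × M_h` solves `a((u_h,σ_h),(v_h,τ_h)) = 2 ℓ(v_h)` for all
`(v_h,τ_h) ∈ V_h × M_h`. -/
def IsDiscreteSolution (𝒯 : Mesh d Ω) (k : ℕ) (M : Submodule ℝ (L2Vec Ω)) (ℓ : HNegOne Ω)
    (p : H1 Ω × L2Vec Ω) : Prop :=
  p.1 ∈ Vh 𝒯 k ∧ p.2 ∈ M ∧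
    ∀ v : H10 Ω, (v : H1 Ω) ∈ Vh 𝒯 k → ∀ τ ∈ M, bilin Ω p.1 p.2 v τ = 2 * ℓ v

end MeshDefs

end PoissonFEM

end

namespace PoissonFEM

variable {d : ℕ} {Ω : Set (Space d)}

/-! ### The Poincaré inequality -/

/-! The form is coercive on all of $H^1_0\times[L^2]^d$, hence on every pair of subspaces, and no
inf-sup condition links $V_h$ to $\mathbf M_h$. Indeed
$a((v,\tau),(v,\tau))=\|\tau\|_0^2+\|\tau-2\nabla v\|_0^2$; the triangle inequality bounds
$2\|\nabla v\|_0$ by the two norms on the right, and the Poincaré inequality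
(`exists_norm_le_norm_grad`) then bounds $\|v\|_1$. The exact pair is consistent: since
$\sigma-2\nabla u=-\sigma$ for $\sigma=\nabla u$, the terms in $\tau$ cancel and
$a((u,\sigma),(v,\tau))=2(\nabla u,\nabla v)_0=2\ell(v)$ by the Euler–Lagrange equation. Galerkin
orthogonality and Céa's argument (`galerkin_error_le`) give the error bound with constant $2C+5$,
where $C$ is the Poincaré constant of $\Omega$. Unique solvability (`existsUnique_galerkin`) follows
from definiteness once the discrete spaces are known to be finite-dimensional; this holds because
the open elements fill $\Omega$ up to a null set, so that finitely many polynomials determine a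
discrete function. -/

theorem IsTestFunction.zero_of_notMem {φ : Space d → ℝ} (h : IsTestFunction Ω φ) {x : Space d}
    (hx : x ∉ Ω) : φ x = 0 :=
  image_eq_zero_of_notMem_tsupport fun h' => hx (h.support h')

theorem IsTestFunction.mul_coord {φ : Space d → ℝ} (h : IsTestFunction Ω φ) (j : Fin d) :
    IsTestFunction Ω (fun x => x j * φ x) where
  smooth := by
    have : ContDiff ℝ ∞ (fun x : Space d => x j) :=
      (EuclideanSpace.proj j : Space d →L[ℝ] ℝ).contDiff
    exact this.mul h.smooth
  compact := h.compact.mul_left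
  support := (tsupport_mul_subset_right (f := fun x : Space d => x j) (g := φ)).trans h.support

theorem IsTestFunction.partialDeriv_mul_coord {φ : Space d → ℝ} (h : IsTestFunction Ω φ)
    (j : Fin d) (x : Space d) :
    partialDeriv j (fun x => x j * φ x) x = φ x + x j * partialDeriv j φ x := by
  have hc : HasFDerivAt (fun x : Space d => x j) (EuclideanSpace.proj j : Space d →L[ℝ] ℝ) x :=
    (EuclideanSpace.proj j : Space d →L[ℝ] ℝ).hasFDerivAt
  have hφ : HasFDerivAt φ (fderiv ℝ φ x) x :=
    (h.smooth.differentiable (by simp) x).hasFDerivAt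
  unfold partialDeriv
  have hm : HasFDerivAt (fun x : Space d => x j * φ x) _ x := hc.mul hφ
  rw [hm.fderiv]
  simp
  ring

theorem IsTestFunction.continuous_partialDeriv {φ : Space d → ℝ} (h : IsTestFunction Ω φ)
    (j : Fin d) : Continuous (partialDeriv j φ) :=
  (h.smooth.continuous_fderiv (by simp)).clm_apply continuous_const

/-- Integration by parts for two test functions. -/
theorem IsTestFunction.integral_mul_partialDeriv {φ ψ : Space d → ℝ} (hφ : IsTestFunction Ω φ)
    (hψ : IsTestFunction Ω ψ) (j : Fin d) :
    ∫ x in Ω, φ x * partialDeriv j ψ x = - ∫ x in Ω, partialDeriv j φ x * ψ x := by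
  rw [setIntegral_eq_integral_of_forall_compl_eq_zero, setIntegral_eq_integral_of_forall_compl_eq_zero]
  · have hcφ := hφ.smooth.continuous
    have hcψ := hψ.smooth.continuous
    refine integral_mul_fderiv_eq_neg_fderiv_mul_of_integrable ?_ ?_ ?_ ?_ ?_
    · exact ((hφ.continuous_partialDeriv j).mul hcψ).integrable_of_hasCompactSupport
        hψ.compact.mul_left
    · exact (hcφ.mul (hψ.continuous_partialDeriv j)).integrable_of_hasCompactSupport
        hφ.compact.mul_right
    · exact (hcφ.mul hcψ).integrable_of_hasCompactSupport hφ.compact.mul_right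
    · exact fun x _ => hφ.smooth.differentiable (by simp) x
    · exact fun x _ => hψ.smooth.differentiable (by simp) x
  · intro x hx
    rw [hψ.zero_of_notMem hx, mul_zero]
  · intro x hx
    rw [hφ.zero_of_notMem hx, zero_mul]

theorem L2_norm_sq {E : Type*} [NormedAddCommGroup E] [InnerProductSpace ℝ E]
    {μ : Measure (Space d)} (f : Lp E 2 μ) : ‖f‖ ^ 2 = ∫ x, ‖f x‖ ^ 2 ∂μ := by
  rw [← real_inner_self_eq_norm_sq, L2.inner_def]
  simp

/-- Take $\psi=x_j\varphi$ as test function. With $P=\int\varphi^2$ and $A=\int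
x_j\varphi\,\partial_j\varphi$, the product rule and classical integration by parts give $P+A=-A$,
while the weak gradient $g$ gives $P+A=-\int g_jx_j\varphi$. Hence $P=-2\int g_jx_j\varphi$, without
identifying $g_j$ with $\partial_j\varphi$. -/
theorem norm_toL2_sq_le_of_mem_testFunctions {R : ℝ} (hΩ : MeasurableSet Ω)
    (hR : ∀ x ∈ Ω, ‖x‖ ≤ R) (j : Fin d) {w : H1 Ω} (hw : w ∈ testFunctions Ω) :
    ‖H1.toL2 Ω w‖ ^ 2 ≤ 4 * R ^ 2 * ‖H1.grad Ω w‖ ^ 2 := by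
  obtain ⟨φ, hφ, hwφ⟩ := hw
  have hψ := hφ.mul_coord j
  set g := H1.grad Ω w with hg
  have hφ2 : Integrable (fun x => φ x * φ x) (volume.restrict Ω) := hφ.memLp.integrable_mul hφ.memLp
  have hA : Integrable (fun x => φ x * (x j * partialDeriv j φ x)) (volume.restrict Ω) := by
    have := (hψ.memLp).integrable_mul (hφ.memLp_partialDeriv j)
    refine this.congr (ae_of_all _ fun x => ?_)
    simp only [Pi.mul_apply]
    ring
  have hB : Integrable (fun x => g x j * (x j * φ x)) (volume.restrict Ω) :=
    (L2Vec.memLp_coord g j).integrable_mul hψ.memLp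
  have hsplit : ∫ x in Ω, φ x * partialDeriv j (fun x => x j * φ x) x
      = (∫ x in Ω, φ x * φ x) + ∫ x in Ω, φ x * (x j * partialDeriv j φ x) := by
    rw [← integral_add hφ2 hA]
    refine integral_congr_ae (ae_of_all _ fun x => ?_)
    simp only [hφ.partialDeriv_mul_coord]
    ring
  have hparts := hφ.integral_mul_partialDeriv hψ j
  have hAeq : ∫ x in Ω, partialDeriv j φ x * (x j * φ x)
      = ∫ x in Ω, φ x * (x j * partialDeriv j φ x) :=
    integral_congr_ae (ae_of_all _ fun x => by ring)
  have hweak : ∫ x in Ω, φ x * partialDeriv j (fun x => x j * φ x) x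
      = - ∫ x in Ω, g x j * (x j * φ x) := by
    refine Eq.trans ?_ (w.2 _ hψ j)
    refine integral_congr_ae ?_
    filter_upwards [hwφ] with x hx
    rw [← hx]
    rfl
  have hP : ‖H1.toL2 Ω w‖ ^ 2 = ∫ x in Ω, φ x * φ x := by
    rw [L2_norm_sq]
    refine integral_congr_ae ?_
    filter_upwards [hwφ] with x hx
    rw [hx, Real.norm_eq_abs, sq_abs, sq]
  have hg2 : Integrable (fun x => ‖g x‖ ^ 2) (volume.restrict Ω) :=
    (Lp.memLp g).integrable_norm_pow (by simp)
  -- Young's inequality in the form $(\varphi+2g_jx_j)^2\ge0$. The left side equals $2P$, so one $P$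
  -- is absorbed and the factor $4R^2$ remains.
  have hbound : -(4 * ∫ x in Ω, g x j * (x j * φ x))
      ≤ (∫ x in Ω, φ x * φ x) + 4 * R ^ 2 * ∫ x in Ω, ‖g x‖ ^ 2 := by
    rw [← integral_const_mul, ← integral_const_mul, ← integral_neg,
      ← integral_add hφ2 (hg2.const_mul _)]
    refine setIntegral_mono_on (hB.const_mul _).neg (hφ2.add (hg2.const_mul _)) hΩ fun x hx => ?_
    have h1 : |x j| ≤ R := (PiLp.norm_apply_le x j).trans (hR x hx)
    have h2 : |g x j| ≤ ‖g x‖ := PiLp.norm_apply_le (g x) j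
    have h3 : (g x j * x j) ^ 2 ≤ R ^ 2 * ‖g x‖ ^ 2 := by
      rw [← sq_abs, abs_mul, ← mul_pow, mul_comm R]
      gcongr
    nlinarith [sq_nonneg (φ x + 2 * (g x j * x j))]
  rw [L2_norm_sq g, hP]
  linarith

theorem H1.norm_sq (w : H1 Ω) : ‖w‖ ^ 2 = ‖H1.toL2 Ω w‖ ^ 2 + ‖H1.grad Ω w‖ ^ 2 :=
  WithLp.prod_norm_sq_eq_of_L2 w.1

theorem H1.continuous_toL2 : Continuous (H1.toL2 Ω) :=
  (WithLp.fstL 2 ℝ (L2 Ω) (L2Vec Ω)).continuous.comp continuous_subtype_val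

theorem H1.continuous_grad : Continuous (H1.grad Ω) :=
  (WithLp.sndL 2 ℝ (L2 Ω) (L2Vec Ω)).continuous.comp continuous_subtype_val

theorem H1.norm_grad_le (w : H1 Ω) : ‖H1.grad Ω w‖ ≤ ‖w‖ := by
  have := H1.norm_sq w
  exact abs_le_of_sq_le_sq' (by nlinarith [sq_nonneg ‖H1.toL2 Ω w‖]) (norm_nonneg _) |>.2

/-- The Poincaré inequality on `H¹₀(Ω)`: the gradient controls the `H¹` norm. -/
theorem exists_norm_le_norm_grad (hd : 0 < d) (hΩ : MeasurableSet Ω)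
    (hb : Bornology.IsBounded Ω) :
    ∃ C : ℝ, 0 < C ∧ ∀ w ∈ H10 Ω, ‖w‖ ≤ C * ‖H1.grad Ω w‖ := by
  obtain ⟨R, hR⟩ := hb.exists_norm_le
  -- Both sides are continuous in the $H^1$ norm, so the estimate passes from test functions to
  -- their closure.
  have key : ∀ w ∈ H10 Ω, ‖H1.toL2 Ω w‖ ^ 2 ≤ 4 * R ^ 2 * ‖H1.grad Ω w‖ ^ 2 := by
    intro w hw
    have hcl : IsClosed {w : H1 Ω | ‖H1.toL2 Ω w‖ ^ 2 ≤ 4 * R ^ 2 * ‖H1.grad Ω w‖ ^ 2} :=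
      isClosed_le (H1.continuous_toL2.norm.pow 2)
        (continuous_const.mul (H1.continuous_grad.norm.pow 2))
    exact closure_minimal (fun v hv =>
      norm_toL2_sq_le_of_mem_testFunctions hΩ hR ⟨0, hd⟩ hv) hcl hw
  -- Chosen because $1+4R^2\le(1+2|R|)^2$.
  refine ⟨1 + 2 * |R|, by positivity, fun w hw => ?_⟩
  refine (abs_le_of_sq_le_sq' ?_ (by positivity)).2
  have h := key w hw
  rw [H1.norm_sq, mul_pow]
  have := sq_abs R
  nlinarith [mul_nonneg (abs_nonneg R) (sq_nonneg ‖H1.grad Ω w‖)]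

/-! ### An element of `H¹(Ω)` is determined by its function -/

/-- A weak gradient of the zero function is orthogonal to all test functions, so it vanishes by the
fundamental lemma of the calculus of variations. This lets $V_h$ inherit its finite dimension from
$L_h$. -/
theorem H1.toL2_injective (hΩ : IsOpen Ω) : Function.Injective (H1.toL2 Ω) := by
  rw [injective_iff_map_eq_zero]
  intro w hw
  have hgrad : H1.grad Ω w = 0 := by
    rw [Lp.eq_zero_iff_ae_eq_zero]
    have hcoord : ∀ j, ∀ᵐ x ∂(volume.restrict Ω), H1.grad Ω w x j = 0 := by
      intro j
      rw [ae_restrict_iff' hΩ.measurableSet]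
      refine hΩ.ae_eq_zero_of_integral_contDiff_smul_eq_zero ?_ ?_
      · have hloc : LocallyIntegrable (fun x => H1.grad Ω w x j) (volume.restrict Ω) :=
          (L2Vec.memLp_coord (H1.grad Ω w) j).locallyIntegrable (by norm_num)
        exact locallyIntegrableOn_of_locallyIntegrable_restrict hloc
      · intro φ h1 h2 h3
        have hφ : IsTestFunction Ω φ := ⟨h1, h2, h3⟩
        have hweak : ∫ x in Ω, H1.toL2 Ω w x * partialDeriv j φ x
            = - ∫ x in Ω, H1.grad Ω w x j * φ x := w.2 φ hφ j
        have hzero : ∫ x in Ω, H1.toL2 Ω w x * partialDeriv j φ x = 0 := by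
          refine integral_eq_zero_of_ae ?_
          rw [hw]
          filter_upwards [Lp.coeFn_zero ℝ 2 (volume.restrict Ω)] with x hx
          rw [hx, Pi.zero_apply, zero_mul]
        rw [hzero] at hweak
        rw [← setIntegral_eq_integral_of_forall_compl_eq_zero (s := Ω)]
        · simp only [smul_eq_mul, mul_comm (φ _)]
          linarith
        · intro x hx
          rw [hφ.zero_of_notMem hx, zero_smul]
    filter_upwards [ae_all_iff.2 hcoord] with x hx
    ext j
    exact hx j
  have h := H1.norm_sq w
  rw [hw, hgrad] at h
  simpa using h

/-! ### The elements of a mesh cover the domain up to a null set -/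

theorem Shape.convex_ref (s : Shape) : Convex ℝ (s.ref d) := by
  cases s
  · rintro x ⟨hx, hx'⟩ y ⟨hy, hy'⟩ a b ha hb hab
    have hpos : 0 < a ∨ 0 < b := by
      by_contra! h
      linarith
    refine ⟨fun i => ?_, ?_⟩
    · have h1 := mul_nonneg ha (hx i).le
      have h2 := mul_nonneg hb (hy i).le
      simp only [PiLp.add_apply, PiLp.smul_apply, smul_eq_mul]
      rcases hpos with h | h
      · linarith [mul_pos h (hx i)]
      · linarith [mul_pos h (hy i)]
    · simp only [PiLp.add_apply, PiLp.smul_apply, smul_eq_mul, Finset.sum_add_distrib,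
        ← Finset.mul_sum]
      rcases hpos with h | h
      · nlinarith
      · nlinarith
  · rintro x hx y hy a b ha hb hab i
    exact (convex_Ioo (0 : ℝ) 1) (hx i) (hy i) ha hb hab

theorem Shape.isBounded_ref (s : Shape) : Bornology.IsBounded (s.ref d) := by
  have hsub : s.ref d ⊆ WithLp.ofLp ⁻¹' (Icc (0 : Fin d → ℝ) 1) := by
    intro x hx
    cases s
    · refine ⟨fun i => (hx.1 i).le, fun i => ?_⟩
      exact (Finset.single_le_sum (fun j _ => (hx.1 j).le) (Finset.mem_univ i)).trans hx.2.le
    · exact ⟨fun i => (hx i).1.le, fun i => (hx i).2.le⟩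
  refine Bornology.IsBounded.subset ?_ hsub
  have hc : IsCompact (Icc (0 : Fin d → ℝ) 1) := isCompact_Icc
  exact ((EuclideanSpace.equiv (Fin d) ℝ).toHomeomorph.isCompact_preimage.2 hc).isBounded

theorem differentiable_eval_mvPolynomial (p : MvPolynomial (Fin d) ℝ) :
    Differentiable ℝ (fun x : Space d => MvPolynomial.eval x p) := by
  induction p using MvPolynomial.induction_on with
  | C a => simp
  | add p q hp hq =>
    simp only [map_add]
    exact hp.add hq
  | mul_X p i hp =>
    have : Differentiable ℝ (fun x : Space d => x i) :=
      (EuclideanSpace.proj i : Space d →L[ℝ] ℝ).differentiable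
    simp only [map_mul, MvPolynomial.eval_X]
    exact hp.mul this

theorem Mesh.differentiable_map (𝒯 : Mesh d Ω) (i : Fin 𝒯.n) : Differentiable ℝ (𝒯.map i) := by
  rw [differentiable_euclidean]
  intro j
  obtain ⟨p, -, hp⟩ := 𝒯.map_poly i j
  simp only [hp]
  exact differentiable_eval_mvPolynomial p

/-- By compactness, $\overline{F_T(\hat T)}\subset F_T(\overline{\hat T})$, so the difference lies
in the image of the boundary of $\hat T$. That boundary is null because $\hat T$ is convex, and
differentiable maps preserve null sets. -/
theorem Mesh.volume_closure_sdiff_element (𝒯 : Mesh d Ω) (i : Fin 𝒯.n) :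
    volume (closure (𝒯.element i) \ 𝒯.element i) = 0 := by
  set K := (𝒯.shape i).ref d
  have hcomp : IsCompact (closure K) := (𝒯.shape i).isBounded_ref.isCompact_closure
  have hcont : Continuous (𝒯.map i) := (𝒯.differentiable_map i).continuous
  have hcl : closure (𝒯.element i) ⊆ 𝒯.map i '' closure K :=
    closure_minimal (image_mono subset_closure) (hcomp.image hcont).isClosed
  have hsub : closure (𝒯.element i) \ 𝒯.element i ⊆ 𝒯.map i '' (closure K \ K) := by
    rintro y ⟨hy, hy'⟩
    obtain ⟨x, hx, rfl⟩ := hcl hy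
    exact ⟨x, ⟨hx, fun h => hy' ⟨x, h, rfl⟩⟩, rfl⟩
  have hnull : volume (closure K \ K) = 0 := by
    refine measure_mono_null ?_ ((𝒯.shape i).convex_ref.addHaar_frontier volume)
    exact sdiff_subset_sdiff_right interior_subset
  exact measure_mono_null hsub (addHaar_image_eq_zero_of_differentiableOn_of_addHaar_eq_zero
    volume (𝒯.differentiable_map i).differentiableOn hnull)

theorem Mesh.ae_mem_element (𝒯 : Mesh d Ω) (hΩ : MeasurableSet Ω) :
    ∀ᵐ x ∂(volume.restrict Ω), ∃ i, x ∈ 𝒯.element i := by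
  have h : ∀ᵐ x ∂(volume : Measure (Space d)), ∀ i, x ∉ closure (𝒯.element i) \ 𝒯.element i :=
    ae_all_iff.2 fun i => measure_eq_zero_iff_ae_notMem.1 (𝒯.volume_closure_sdiff_element i)
  rw [ae_restrict_iff' hΩ]
  filter_upwards [h] with x hx hxΩ
  have hxcl : x ∈ ⋃ i, closure (𝒯.element i) := by
    rw [show ⋃ i, closure (𝒯.element i) = closure Ω from 𝒯.cover]
    exact subset_closure hxΩ
  obtain ⟨i, hi⟩ := mem_iUnion.1 hxcl
  exact ⟨i, by_contra fun hn => hx i ⟨hi, hn⟩⟩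

/-! ### The finite element spaces are finite-dimensional -/

instance Shape.finite_poly (k : ℕ) (s : Shape) : Module.Finite ℝ (s.poly d k) := by
  cases s
  · exact inferInstanceAs (Module.Finite ℝ (MvPolynomial.restrictTotalDegree (Fin d) ℝ k))
  · exact inferInstanceAs (Module.Finite ℝ (MvPolynomial.restrictDegree (Fin d) ℝ k))

/-- The pairs of a family of polynomials on the reference elements and the function in `L_h` that
it represents. -/
def Mesh.polyGraph (𝒯 : Mesh d Ω) (k : ℕ) :
    Submodule ℝ ((∀ i, (𝒯.shape i).poly d k) × L2 Ω) where
  carrier := {q | ∃ r : Space d → ℝ, (∀ i, ∀ x ∈ (𝒯.shape i).ref d,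
    r (𝒯.map i x) = MvPolynomial.eval x (q.1 i : MvPolynomial (Fin d) ℝ)) ∧
      q.2 =ᵐ[volume.restrict Ω] r}
  add_mem' := by
    rintro p q ⟨r, hr, hp⟩ ⟨s, hs, hq⟩
    exact ⟨r + s, fun i x hx => by simp [hr i x hx, hs i x hx],
      (Lp.coeFn_add _ _).trans (hp.add hq)⟩
  zero_mem' := ⟨0, fun _ _ _ => by simp, Lp.coeFn_zero _ _ _⟩
  smul_mem' := by
    rintro c p ⟨r, hr, hp⟩
    exact ⟨c • r, fun i x hx => by simp [hr i x hx],
      (Lp.coeFn_smul _ _).trans (hp.const_smul c)⟩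

/-- The graph `polyGraph` projects injectively to the finite-dimensional space of polynomial
families, since zero polynomials force the function to vanish almost everywhere on $\Omega$. Its
other projection covers $L_h$. -/
theorem finiteDimensional_Lh (𝒯 : Mesh d Ω) (hΩ : MeasurableSet Ω) (k : ℕ) :
    FiniteDimensional ℝ (Lh 𝒯 k) := by
  have hinj : Function.Injective
      ((LinearMap.fst ℝ (∀ i, (𝒯.shape i).poly d k) (L2 Ω)).domRestrict (𝒯.polyGraph k)) := by
    rw [injective_iff_map_eq_zero]
    rintro ⟨⟨P, w⟩, r, hr, hw⟩ (h : P = 0)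
    subst h
    have hw0 : w = 0 := by
      rw [Lp.eq_zero_iff_ae_eq_zero]
      filter_upwards [hw, 𝒯.ae_mem_element hΩ] with x hx ⟨i, y, hy, hyx⟩
      change w x = r x at hx
      rw [hx, ← hyx, hr i y hy]
      simp
    subst hw0
    rfl
  have : FiniteDimensional ℝ (𝒯.polyGraph k) := FiniteDimensional.of_injective _ hinj
  refine Submodule.finiteDimensional_of_le
    (S₂ := (𝒯.polyGraph k).map (LinearMap.snd ℝ _ (L2 Ω))) ?_
  rintro w ⟨r, hr, hw⟩
  choose p hp hp' using hr
  exact ⟨(fun i => ⟨p i, hp i⟩, w), ⟨r, hp', hw⟩, rfl⟩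

theorem finiteDimensional_vectorFields (W : Submodule ℝ (L2 Ω)) [FiniteDimensional ℝ W] :
    FiniteDimensional ℝ (vectorFields W) := by
  let f : vectorFields W →ₗ[ℝ] Fin d → W := LinearMap.pi fun j =>
    ((component Ω j).toLinearMap.domRestrict (vectorFields W)).codRestrict W fun σ =>
      (Submodule.mem_iInf _).1 σ.2 j
  refine FiniteDimensional.of_injective f ?_
  rw [injective_iff_map_eq_zero]
  intro σ hσ
  have hcomp : ∀ j, component Ω j σ = 0 := fun j => congrArg Subtype.val (congrFun hσ j)
  have hae : ∀ j, ∀ᵐ x ∂(volume.restrict Ω), (σ : L2Vec Ω) x j = 0 := by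
    intro j
    have h1 := (Lp.eq_zero_iff_ae_eq_zero).1 (hcomp j)
    filter_upwards [h1, (EuclideanSpace.proj j : Space d →L[ℝ] ℝ).coeFn_compLp (σ : L2Vec Ω)]
      with x hx hx'
    exact hx'.symm.trans hx
  refine Subtype.ext ((Lp.eq_zero_iff_ae_eq_zero).2 ?_)
  filter_upwards [ae_all_iff.2 hae] with x hx
  ext j
  exact hx j

theorem map_Vh_le_Lh (𝒯 : Mesh d Ω) (k : ℕ) : (Vh 𝒯 k).map (H1.toL2 Ω) ≤ Lh 𝒯 k := by
  rintro _ ⟨w, ⟨⟨r, -, hr, hw⟩, -⟩, rfl⟩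
  exact ⟨r, hr, hw⟩

theorem finiteDimensional_Vh (𝒯 : Mesh d Ω) (hΩ : IsOpen Ω) (k : ℕ) :
    FiniteDimensional ℝ (Vh 𝒯 k) := by
  have := finiteDimensional_Lh 𝒯 hΩ.measurableSet k
  have := Submodule.finiteDimensional_of_le (map_Vh_le_Lh 𝒯 k)
  exact LinearEquiv.finiteDimensional
    (Submodule.equivMapOfInjective _ (H1.toL2_injective hΩ) (Vh 𝒯 k)).symm

theorem finiteDimensional_Qh (𝒯 : Mesh d Ω) (hΩ : MeasurableSet Ω) (k : ℕ) :
    FiniteDimensional ℝ (Qh 𝒯 k) := by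
  have := finiteDimensional_Lh 𝒯 hΩ k
  exact finiteDimensional_vectorFields (Lh 𝒯 k)

theorem finiteDimensional_VhVec (𝒯 : Mesh d Ω) (hΩ : MeasurableSet Ω) (k : ℕ) :
    FiniteDimensional ℝ (VhVec 𝒯 k) := by
  have := finiteDimensional_Lh 𝒯 hΩ k
  have := Submodule.finiteDimensional_of_le (map_Vh_le_Lh 𝒯 k)
  exact finiteDimensional_vectorFields ((Vh 𝒯 k).map (H1.toL2 Ω))

/-! ### The least-squares form over an abstract gradient -/

section LeastSquares

variable {V Q : Type*} [NormedAddCommGroup V] [NormedSpace ℝ V] [NormedAddCommGroup Q]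
  [InnerProductSpace ℝ Q] (G : V →ₗ[ℝ] Q)

/-- The form `a((u,σ),(v,τ)) = (σ,τ) + (σ - 2Gu, τ - 2Gv)` for a linear map `G` in place of the
gradient. -/
noncomputable def leastSquaresForm : (V × Q) →ₗ[ℝ] (V × Q) →ₗ[ℝ] ℝ :=
  (innerₗ Q).compl₁₂ (LinearMap.snd ℝ V Q) (LinearMap.snd ℝ V Q) +
    (innerₗ Q).compl₁₂ (LinearMap.snd ℝ V Q - (2 : ℝ) • G ∘ₗ LinearMap.fst ℝ V Q)
      (LinearMap.snd ℝ V Q - (2 : ℝ) • G ∘ₗ LinearMap.fst ℝ V Q)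

theorem leastSquaresForm_apply (p q : V × Q) :
    leastSquaresForm G p q = inner ℝ p.2 q.2 +
      inner ℝ (p.2 - (2 : ℝ) • G p.1) (q.2 - (2 : ℝ) • G q.1) :=
  rfl

theorem leastSquaresForm_self (p : V × Q) :
    leastSquaresForm G p p = ‖p.2‖ ^ 2 + ‖p.2 - (2 : ℝ) • G p.1‖ ^ 2 := by
  simp only [leastSquaresForm_apply, real_inner_self_eq_norm_sq]

theorem two_mul_norm_le (p : V × Q) : 2 * ‖G p.1‖ ≤ ‖p.2‖ + ‖p.2 - (2 : ℝ) • G p.1‖ := by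
  have h := norm_sub_le p.2 (p.2 - (2 : ℝ) • G p.1)
  rwa [sub_sub_cancel, norm_smul, Real.norm_two] at h

variable {G}

/-- Coercivity of the least-squares form where `G` controls the norm. -/
theorem norm_add_norm_le_of_leastSquaresForm_self_le {C F : ℝ} {p : V × Q} (hC : 0 ≤ C)
    (hF : 0 ≤ F) (hp : ‖p.1‖ ≤ C * ‖G p.1‖)
    (h : leastSquaresForm G p p ≤ F * (‖p.2‖ + ‖p.2 - (2 : ℝ) • G p.1‖)) :
    ‖p.1‖ + ‖p.2‖ ≤ (C + 2) * F := by
  rw [leastSquaresForm_self] at h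
  have hA := norm_nonneg p.2
  have hD := norm_nonneg (p.2 - (2 : ℝ) • G p.1)
  have hG := two_mul_norm_le G p
  set A := ‖p.2‖
  set D := ‖p.2 - (2 : ℝ) • G p.1‖
  -- $(A+D)^2\le2(A^2+D^2)\le2F(A+D)$, divided by $A+D$ when it is positive.
  have hsum : A + D ≤ 2 * F := by
    rcases (add_nonneg hA hD).eq_or_lt with h0 | hpos
    · linarith
    · refine le_of_mul_le_mul_right ?_ hpos
      nlinarith [sq_nonneg (A - D)]
  have hgrad : ‖G p.1‖ ≤ F := by linarith
  linarith [mul_le_mul_of_nonneg_left hgrad hC]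

/-- Continuity of the least-squares form. -/
theorem leastSquaresForm_le (hG : ∀ v, ‖G v‖ ≤ ‖v‖) (p q : V × Q) :
    leastSquaresForm G p q ≤
      (2 * (‖p.1‖ + ‖p.2‖)) * (‖q.2‖ + ‖q.2 - (2 : ℝ) • G q.1‖) := by
  rw [leastSquaresForm_apply]
  have h1 := real_inner_le_norm p.2 q.2
  have h2 := real_inner_le_norm (p.2 - (2 : ℝ) • G p.1) (q.2 - (2 : ℝ) • G q.1)
  have h3 : ‖p.2 - (2 : ℝ) • G p.1‖ ≤ 2 * (‖p.1‖ + ‖p.2‖) := by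
    refine (norm_sub_le _ _).trans ?_
    rw [norm_smul, Real.norm_two]
    linarith [hG p.1, norm_nonneg p.2]
  have h4 : ‖p.2‖ ≤ 2 * (‖p.1‖ + ‖p.2‖) := by linarith [norm_nonneg p.2, norm_nonneg p.1]
  have h5 := mul_le_mul_of_nonneg_right h3 (norm_nonneg (q.2 - (2 : ℝ) • G q.1))
  have h6 := mul_le_mul_of_nonneg_right h4 (norm_nonneg q.2)
  linarith

theorem eq_zero_of_leastSquaresForm_self_eq_zero {C : ℝ} {p : V × Q}
    (hp : ‖p.1‖ ≤ C * ‖G p.1‖) (h : leastSquaresForm G p p = 0) : p = 0 := by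
  rw [leastSquaresForm_self] at h
  have hτ : ‖p.2‖ = 0 := by nlinarith [sq_nonneg ‖p.2‖, sq_nonneg ‖p.2 - (2 : ℝ) • G p.1‖]
  have hD : ‖p.2 - (2 : ℝ) • G p.1‖ = 0 := by
    nlinarith [sq_nonneg ‖p.2‖, sq_nonneg ‖p.2 - (2 : ℝ) • G p.1‖]
  have hG := two_mul_norm_le G p
  have hg : ‖G p.1‖ = 0 := le_antisymm (by linarith) (norm_nonneg _)
  rw [hg, mul_zero] at hp
  exact Prod.ext (norm_le_zero_iff.1 hp) (norm_eq_zero.1 hτ)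

/-- A bilinear form that is definite on a finite-dimensional space represents every linear
functional exactly once. -/
theorem existsUnique_forall_eq_of_definite {X : Type*} [AddCommGroup X] [Module ℝ X]
    [FiniteDimensional ℝ X] (B : X →ₗ[ℝ] X →ₗ[ℝ] ℝ) (hB : ∀ x, B x x = 0 → x = 0)
    (f : X →ₗ[ℝ] ℝ) : ∃! x, ∀ y, B x y = f y := by
  have hinj : Function.Injective B := by
    rw [injective_iff_map_eq_zero]
    intro x hx
    exact hB x (by rw [hx]; rfl)
  have hsurj : Function.Surjective B :=
    (LinearMap.injective_iff_surjective_of_finrank_eq_finrank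
      (V₂ := Module.Dual ℝ X) Subspace.dual_finrank_eq.symm).1 hinj
  obtain ⟨x, hx⟩ := hsurj f
  exact ⟨x, fun y => by rw [hx], fun z hz => hinj (by rw [hx]; exact LinearMap.ext hz)⟩

/-- Unique solvability of the Galerkin equations on finite-dimensional spaces. -/
theorem existsUnique_galerkin {C : ℝ} {V₀ W : Submodule ℝ V} (hW : W ≤ V₀)
    (hC : ∀ v ∈ V₀, ‖v‖ ≤ C * ‖G v‖) (M : Submodule ℝ Q) [FiniteDimensional ℝ W]
    [FiniteDimensional ℝ M] (ℓ : V₀ →ₗ[ℝ] ℝ) :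
    ∃! p : V × Q, p.1 ∈ W ∧ p.2 ∈ M ∧ ∀ v : V₀, (v : V) ∈ W → ∀ τ ∈ M,
      leastSquaresForm G p (v, τ) = 2 * ℓ v := by
  let ι : (W × M) →ₗ[ℝ] V × Q := W.subtype.prodMap M.subtype
  let f : (W × M) →ₗ[ℝ] ℝ := (2 : ℝ) • (ℓ ∘ₗ Submodule.inclusion hW ∘ₗ LinearMap.fst ℝ W M)
  obtain ⟨⟨u, σ⟩, h, huniq⟩ := existsUnique_forall_eq_of_definite
    ((leastSquaresForm G).compl₁₂ ι ι) (fun x hx => by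
      have h0 : ι x = 0 := eq_zero_of_leastSquaresForm_self_eq_zero (hC _ (hW x.1.2)) hx
      exact Prod.ext (Subtype.ext (congrArg Prod.fst h0)) (Subtype.ext (congrArg Prod.snd h0))) f
  refine ⟨(u, σ), ⟨u.2, σ.2, fun v hv τ hτ => h (⟨v, hv⟩, ⟨τ, hτ⟩)⟩, ?_⟩
  rintro ⟨u', σ'⟩ ⟨hu', hσ', h'⟩
  have heq := huniq (⟨u', hu'⟩, ⟨σ', hσ'⟩) fun y => h' ⟨y.1, hW y.1.2⟩ y.1.2 y.2 y.2.2
  exact congrArg ι heq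

/-- The Euler–Lagrange equation for a minimiser of the energy. -/
theorem inner_eq_of_forall_energy_le {V₀ : Submodule ℝ V} {ℓ : V₀ →ₗ[ℝ] ℝ} {u : V₀}
    (hu : ∀ v : V₀, 1 / 2 * ‖G u‖ ^ 2 - ℓ u ≤ 1 / 2 * ‖G v‖ ^ 2 - ℓ v) (v : V₀) :
    inner ℝ (G u) (G v) = ℓ v := by
  -- The energy difference between $u+tv$ and $u$. This quadratic in $t$ has no constant term, so
  -- its discriminant is the square of the linear coefficient, and nonnegativity forces that
  -- coefficient to vanish.
  have h : ∀ t : ℝ, 0 ≤ (1 / 2 * ‖G v‖ ^ 2) * (t * t) + (inner ℝ (G u) (G v) - ℓ v) * t + 0 := by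
    intro t
    have ht := hu (u + t • v)
    rw [Submodule.coe_add, Submodule.coe_smul, map_add, map_smul, norm_add_sq_real,
      real_inner_smul_right, norm_smul, mul_pow, Real.norm_eq_abs, sq_abs, map_add, map_smul,
      smul_eq_mul] at ht
    linarith
  have hdisc := discrim_le_zero h
  unfold discrim at hdisc
  have hsq : (inner ℝ (G u) (G v) - ℓ v) ^ 2 = 0 := le_antisymm (by linarith) (sq_nonneg _)
  linarith [pow_eq_zero_iff two_ne_zero |>.1 hsq]

/-- Consistency: $Gu-2Gu=-Gu$, so the contributions of the second test component cancel. -/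
theorem leastSquaresForm_map_left (u : V) (q : V × Q) :
    leastSquaresForm G (u, G u) q = 2 * inner ℝ (G u) (G q.1) := by
  rw [leastSquaresForm_apply, two_smul ℝ (G u), sub_add_cancel_left, inner_neg_left,
    inner_sub_right, real_inner_smul_right]
  ring

/-- Céa's lemma for the Galerkin approximation of a minimiser of the energy. -/
theorem galerkin_error_le {C : ℝ} (hC0 : 0 ≤ C) (hG : ∀ v, ‖G v‖ ≤ ‖v‖) {V₀ W : Submodule ℝ V}
    (hW : W ≤ V₀) (hC : ∀ v ∈ V₀, ‖v‖ ≤ C * ‖G v‖) {M : Submodule ℝ Q} {ℓ : V₀ →ₗ[ℝ] ℝ} {u : V₀}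
    (hu : ∀ v : V₀, 1 / 2 * ‖G u‖ ^ 2 - ℓ u ≤ 1 / 2 * ‖G v‖ ^ 2 - ℓ v) {p : V × Q}
    (hp1 : p.1 ∈ W) (hp2 : p.2 ∈ M)
    (hp : ∀ v : V₀, (v : V) ∈ W → ∀ τ ∈ M, leastSquaresForm G p (v, τ) = 2 * ℓ v)
    {q : V × Q} (hq1 : q.1 ∈ W) (hq2 : q.2 ∈ M) :
    ‖(u : V) - p.1‖ + ‖G u - p.2‖ ≤ (2 * C + 5) * (‖(u : V) - q.1‖ + ‖G u - q.2‖) := by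
  have he : (q - p).1 ∈ W := sub_mem hq1 hp1
  have hη : (q - p).2 ∈ M := sub_mem hq2 hp2
  -- Galerkin orthogonality: the discrete and the exact pair give the same value against the
  -- discrete direction $q-p$.
  have horth : leastSquaresForm G (q - p) (q - p)
      = leastSquaresForm G (q - ((u : V), G u)) (q - p) := by
    have h1 : leastSquaresForm G p (q - p) = _ := hp ⟨(q - p).1, hW he⟩ he _ hη
    have h2 := inner_eq_of_forall_energy_le hu ⟨(q - p).1, hW he⟩
    rw [LinearMap.map_sub₂, LinearMap.map_sub₂, leastSquaresForm_map_left, h1, ← h2]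
  -- Here $F=2E$, with $E$ the approximation error of $q$, so the distance from $q$ to $p$ is at
  -- most $2(C+2)E$. The triangle inequality adds one more $E$, hence $2C+5$.
  have hest := norm_add_norm_le_of_leastSquaresForm_self_le hC0 (by positivity) (hC _ (hW he))
    (horth.le.trans (leastSquaresForm_le hG (q - ((u : V), G u)) (q - p)))
  simp only [Prod.fst_sub, Prod.snd_sub] at hest
  rw [norm_sub_rev q.1 (u : V), norm_sub_rev q.2 (G u)] at hest
  have t1 := norm_sub_le_norm_sub_add_norm_sub (u : V) q.1 p.1
  have t2 := norm_sub_le_norm_sub_add_norm_sub (G u) q.2 p.2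
  linarith

end LeastSquares

end PoissonFEM

theorem mainTheorem1 (d : ℕ) (hd : d = 2 ∨ d = 3) (Ω : Set (PoissonFEM.Space d))
    (hΩ : PoissonFEM.IsConvexPolyhedralDomain Ω) :
    ∃ c : ℝ, 0 < c ∧
      ∀ (ρ : ℝ), 0 < ρ → ∀ (𝒯 : PoissonFEM.Mesh d Ω), 𝒯.IsQuasiUniform ρ →
      ∀ (k : ℕ) (ℓ : PoissonFEM.HNegOne Ω) (M : Submodule ℝ (PoissonFEM.L2Vec Ω)),
        (M = PoissonFEM.Qh 𝒯 k ∨ M = PoissonFEM.VhVec 𝒯 k) →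
        (∃! p : PoissonFEM.H1 Ω × PoissonFEM.L2Vec Ω,
          PoissonFEM.IsDiscreteSolution 𝒯 k M ℓ p) ∧
        ∀ (u : PoissonFEM.H10 Ω), PoissonFEM.IsExactSolution Ω ℓ u →
        ∀ (σ : PoissonFEM.L2Vec Ω), σ = PoissonFEM.H1.grad Ω u →
        ∀ (uh : PoissonFEM.H1 Ω) (σh : PoissonFEM.L2Vec Ω),
          PoissonFEM.IsDiscreteSolution 𝒯 k M ℓ (uh, σh) →
          ‖(u : PoissonFEM.H1 Ω) - uh‖ + ‖σ - σh‖ ≤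
            c * ((⨅ vh : PoissonFEM.Vh 𝒯 k, ‖(u : PoissonFEM.H1 Ω) - vh‖) +
              ⨅ τh : M, ‖σ - τh‖) := by
  obtain ⟨-, S, hS, hΩS⟩ := hΩ
  have hopen : IsOpen Ω := hΩS ▸ isOpen_interior
  have hbdd : Bornology.IsBounded Ω :=
    hΩS ▸ (isBounded_convexHull.2 hS.isBounded).subset interior_subset
  have hP := PoissonFEM.exists_norm_le_norm_grad (by omega) hopen.measurableSet hbdd
  obtain ⟨C, hC0, hC⟩ := hP
  have hc : 0 < 2 * C + 5 := by linarith
  refine ⟨2 * C + 5, hc, fun ρ _ 𝒯 _ k ℓ M hM => ⟨?_, ?_⟩⟩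
  · have := PoissonFEM.finiteDimensional_Vh 𝒯 hopen k
    have : FiniteDimensional ℝ M := by
      rcases hM with rfl | rfl
      · exact PoissonFEM.finiteDimensional_Qh 𝒯 hopen.measurableSet k
      · exact PoissonFEM.finiteDimensional_VhVec 𝒯 hopen.measurableSet k
    exact PoissonFEM.existsUnique_galerkin (W := PoissonFEM.Vh 𝒯 k) inf_le_right hC M ℓ.toLinearMap
  · rintro u hu _ rfl uh σh ⟨h1, h2, h⟩
    -- With the constant on the left, the bound for each pair $(v_h,\tau_h)$ passes to the sum of
    -- the two separate infima.
    rw [← div_le_iff₀' hc]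
    exact le_ciInf_add_ciInf fun vh τh => (div_le_iff₀' hc).2 <|
      PoissonFEM.galerkin_error_le hC0.le PoissonFEM.H1.norm_grad_le
        (W := PoissonFEM.Vh 𝒯 k) inf_le_right hC (ℓ := ℓ.toLinearMap) hu
        (p := (uh, σh)) h1 h2 h (q := (vh, τh)) vh.2 τh.2
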